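/- \textbf{Setting.} Let $r\ge 1$, $0\le\epsilon\le 1$, $N=2^n$. Packets are elements of $\{0,1\}^r$, added bitwise modulo 2. The slot erasure channel (SEC) $S(\epsilon)$ outputs its input packet with probability $1-\epsilon$ and an erasure packet $E=(e,\dots,e)$ with probability $\epsilon$. Its capacity is its symmetric capacity $I(S)=\sum_{x,y}2^{-r}S(y|x)\log_2\frac{S(y|x)}{\sum_{x'}2^{-r}S(y|x')}$, that is, the mutual information for uniform input. \textbf{PSA scheme with the SPA-v assignment.} Define $I_1^{(1)}=r(1-\epsilon)$ and, for $1\le j\le N/2$, $I_N^{(2j-1)}=\frac1r\big(I_{N/2}^{(j)}\big)^2$ and $I_N^{(2j)}=2I_{N/2}^{(j)}-\frac1r\big(I_{N/2}^{(j)}\big)^2$. Let $c_1,\dots,c_N$ be the indices $1,\dots,N$ in any order with $I_N^{(c_1)}\ge\dots\ge I_N^{(c_N)}$. There are $M\le N$ active users. User $t$ has a packet $U_t$ (independent, uniform on $\{0,1\}^r$). It takes row $c_{M-t+1}$ of $\begin{pmatrix}1&0\\1&1\end{pmatrix}^{\otimes n}$ as its slot pattern and sends $U_t$ in every slot where this row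 has a $1$. The content of a slot is the sum modulo 2 of the packets sent in it, and the $N$ slots pass through independent uses of $S(\epsilon)$. \textbf{pSC decoding.} Let $\mathcal I=\{c_1,\dots,c_M\}$; the source packets with index outside $\mathcal I$ are zero. The source packets are estimated successively in the order $1,\dots,N$ from the received packets $Y_1^N$ and the earlier estimates, as follows. For $N=1$ the estimate is $Y_1$ if $1\in\mathcal I$ and $0$ otherwise. For $N\ge 2$ and $k\le N/2$, first $Z_k=Y_k\star Y_{k+N/2}$ is formed, where $\star$ is the sum, and is $E$ if one of the two packets is $E$; the first half of the source packets is decoded recursively from $Z$. With $\hat X$ the re-encoding (polar transform, with $\star$ as sum) of these estimates, $Z'_k=g(Y_k,Y_{k+N/2},\hat X_k)$ is formed, where $g$ acts bitwise and returns the bit $u$ with $Y_k=\hat X_k+u$, $Y_{k+N/2}=u$ that is implied by the unerased entries, or $e$ if nothing is implied (which includes the case of an erased $\hat X_k$) or the two entries contradict each other; the second half is decoded recursively from $Z'$. Let $P_u$ be the probability that the packets of all $M$ users are recovered, and let $T=\frac MN P_u$ be the throughput. The asymptotic throughput $T_a$ is the limit, as $N\to\infty$ through powers of two, of the maximal throughput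 $\max_{0\le M\le N}T$. \textbf{Theorem.} This limit exists and $$T_a=\lim_{n\to\infty}\ \max_{0\le M\le N}T=1-\epsilon .$$ Moreover, if the numbers of users $M_n\le 2^n$ satisfy $M_n/2^n\to G<1-\epsilon$, then $P_u\to 1$ and $T\to G$. Finally, $1-\epsilon=I(S)/r$ is the capacity of the SEC per packet. -/

import Mathlib

open scoped Kronecker

namespace PSA

/-- An information packet, or a slotted packet without erasure: `r` bits. The packet-oriented
operation `⊞` (bitwise sum modulo 2) is the addition of this type. -/
abbrev Packet (r : ℕ) : Type := Fin r → ZMod 2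

/-! ### The slot erasure channel -/

/-- Transition probability `S(y | x)` of the slot erasure channel with erasure probability `ε`.
The output `none` is the erasure packet `E`. -/
noncomputable def sec {r : ℕ} (ε : ℝ) (y : Option (Packet r)) (x : Packet r) : ℝ :=
  match y with
  | none => ε
  | some x' => if x' = x then 1 - ε else 0

/-- Symmetric capacity (in bits per channel use) of the slot erasure channel: the mutual
information between input and output for the uniform distribution on the `2 ^ r` inputs. -/
noncomputable def secCapacity (r : ℕ) (ε : ℝ) : ℝ :=
  ∑ x : Packet r, ∑ y : Option (Packet r),
    1 / (2 : ℝ) ^ r * sec ε y x *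
      Real.logb 2 (sec ε y x / ∑ x' : Packet r, 1 / (2 : ℝ) ^ r * sec ε y x')

/-! ### The polar transform -/

/-- Identification of `Fin 2 × Fin (2 ^ n)` with `Fin (2 ^ (n + 1))`; the pair `(b, k)` is sent to
`b * 2 ^ n + k`, so `b` selects the first or the second half. -/
def halves (n : ℕ) : Fin 2 × Fin (2 ^ n) ≃ Fin (2 ^ (n + 1)) :=
  finProdFinEquiv.trans (finCongr (by rw [pow_succ, mul_comm]))

/-- The polarization kernel. -/
def kernelF2 : Matrix (Fin 2) (Fin 2) (ZMod 2) := !![1, 0; 1, 1]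

/-- The `n`-th Kronecker power of the polarization kernel. -/
def polarMatrix : (n : ℕ) → Matrix (Fin (2 ^ n)) (Fin (2 ^ n)) (ZMod 2)
  | 0 => 1
  | n + 1 => Matrix.reindex (halves n) (halves n) (kernelF2 ⊗ₖ polarMatrix n)

/-! ### The SPA-v slot-pattern assignment -/

/-- The capacity metric of the `2 ^ n` synthetic channels, computed by the recursion of the SPA-v
algorithm. The index is counted from `0`, so an even index `2 j` is the "minus" and an odd index
`2 j + 1` the "plus" descendant of the index `j` one level below. -/
noncomputable def capacityMetric (r : ℕ) (ε : ℝ) : ℕ → ℕ → ℝ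
  | 0, _ => r * (1 - ε)
  | n + 1, i =>
    if i % 2 = 0 then 1 / (r : ℝ) * capacityMetric r ε n (i / 2) ^ 2
    else 2 * capacityMetric r ε n (i / 2) - 1 / (r : ℝ) * capacityMetric r ε n (i / 2) ^ 2

/-- `c` lists the indices of the synthetic channels in non-increasing order of their capacity
metric. Ties may be broken in any way. -/
def IsCapacityOrder (r : ℕ) (ε : ℝ) {n : ℕ} (c : Equiv.Perm (Fin (2 ^ n))) : Prop :=
  ∀ i j : Fin (2 ^ n), i ≤ j →
    capacityMetric r ε n (c j : ℕ) ≤ capacityMetric r ε n (c i : ℕ)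

/-- Row index selected by a user: the last of the `M` users takes the first index of the list, ...,
the first user takes the `M`-th one. -/
def rowIndex {n M : ℕ} (c : Equiv.Perm (Fin (2 ^ n))) (hM : M ≤ 2 ^ n) (t : Fin M) :
    Fin (2 ^ n) :=
  c (Fin.castLE hM t.rev)

/-- The slot pattern of user `t`. -/
def slotPattern {n M : ℕ} (c : Equiv.Perm (Fin (2 ^ n))) (hM : M ≤ 2 ^ n) (t : Fin M) :
    Fin (2 ^ n) → ZMod 2 :=
  polarMatrix n (rowIndex c hM t)

/-- The information packet index set: the first `M` entries of the list `c`. -/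
def infoSet {n : ℕ} (c : Equiv.Perm (Fin (2 ^ n))) (M : ℕ) : Finset (Fin (2 ^ n)) :=
  {i | (c.symm i : ℕ) < M}

/-- The slotted packet in slot `k`: the `⊞`-sum of the packets of all users whose slot pattern has
a `1` in position `k`. -/
def slotted {r n M : ℕ} (c : Equiv.Perm (Fin (2 ^ n))) (hM : M ≤ 2 ^ n)
    (U : Fin M → Packet r) (k : Fin (2 ^ n)) : Packet r :=
  ∑ t : Fin M, slotPattern c hM t k • U t

/-! ### The packet-oriented successive cancellation decoder -/

/-- A packet inside the decoder: each component is a bit or the erasure symbol `e = none`. -/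
abbrev EPacket (r : ℕ) : Type := Fin r → Option (ZMod 2)

/-- A packet all of whose bits are known. -/
def known {r : ℕ} (x : Packet r) : EPacket r := fun w => some (x w)

/-- A channel output as a decoder packet; the erasure packet is `E = (e, ..., e)`. -/
def received {r : ℕ} : Option (Packet r) → EPacket r
  | none => fun _ => none
  | some x => known x

/-- The operation `⋆`: sum of two packets, erased where one of them is erased. -/
def starOp {r : ℕ} (a b : EPacket r) : EPacket r := fun w =>
  match a w, b w with
  | some x, some y => some (x + y)
  | _, _ => none

/-- One component of the operation `g`. Given an estimate `u` of the bit `u₁` and observations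
`a` of `u₁ + u₂` and `b` of `u₂`, it returns the implied value of `u₂`, or `e` when there is no
information or the observations contradict each other. -/
def gBit (u a b : Option (ZMod 2)) : Option (ZMod 2) :=
  match u, a, b with
  | some u, some a, some b => if a + u = b then some b else none
  | some u, some a, none => some (a + u)
  | some _, none, some b => some b
  | some _, none, none => none
  | none, _, _ => none

/-- The operation `g`, componentwise. -/
def gOp {r : ℕ} (u a b : EPacket r) : EPacket r := fun w => gBit (u w) (a w) (b w)

/-- Re-encoding of estimated packets by the polar transform, with `⋆` in the place of `⊞`. -/
def reencode {r : ℕ} : (n : ℕ) → (Fin (2 ^ n) → EPacket r) → Fin (2 ^ n) → EPacket r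
  | 0, u => u
  | n + 1, u =>
    let x₀ := reencode n fun k => u (halves n (0, k))
    let x₁ := reencode n fun k => u (halves n (1, k))
    fun i =>
      let p := (halves n).symm i
      if p.1 = 0 then starOp (x₀ p.2) (x₁ p.2) else x₁ p.2

/-- The pSC decoder with information index set `I`. It estimates the source packets one after the
other in the order of their index; packets with index outside `I` are known to be `0`. For `2 ^ (n + 1)`
slots the two halves of the observation are combined by `⋆` to decode the first half of the source
packets, and then, with the re-encoded estimates of the first half, by `g` to decode the second. -/
def pSC {r : ℕ} : (n : ℕ) → Finset (Fin (2 ^ n)) → (Fin (2 ^ n) → EPacket r) →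
    Fin (2 ^ n) → EPacket r
  | 0, I, y => fun i => if i ∈ I then y i else known 0
  | n + 1, I, y =>
    let y₀ := fun k => y (halves n (0, k))
    let y₁ := fun k => y (halves n (1, k))
    let u₀ := pSC n {k | halves n (0, k) ∈ I} fun k => starOp (y₀ k) (y₁ k)
    let x₀ := reencode n u₀
    let u₁ := pSC n {k | halves n (1, k) ∈ I} fun k => gOp (x₀ k) (y₀ k) (y₁ k)
    fun i =>
      let p := (halves n).symm i
      if p.1 = 0 then u₀ p.2 else u₁ p.2

/-! ### Throughput -/

/-- The block error event: some user's packet is not recovered by the pSC decoder from the channel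
output `Y`. -/
def IsBlockError {r n M : ℕ} (c : Equiv.Perm (Fin (2 ^ n))) (hM : M ≤ 2 ^ n)
    (U : Fin M → Packet r) (Y : Fin (2 ^ n) → Option (Packet r)) : Prop :=
  ∃ t : Fin M, pSC n (infoSet c M) (fun k => received (Y k)) (rowIndex c hM t) ≠ known (U t)

open Classical in
/-- Probability of the block error event, for independent uniformly distributed information packets
and independent uses of the slot erasure channel in the `2 ^ n` slots. -/
noncomputable def blockErrorProb (r : ℕ) (ε : ℝ) {n M : ℕ} (c : Equiv.Perm (Fin (2 ^ n)))
    (hM : M ≤ 2 ^ n) : ℝ :=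
  ∑ U : Fin M → Packet r, ∑ Y : Fin (2 ^ n) → Option (Packet r),
    if IsBlockError c hM U Y then
      (1 / (2 : ℝ) ^ r) ^ M * ∏ k, sec ε (Y k) (slotted c hM U k)
    else 0

/-- The probability `P_u` that the packets of all active users are recovered. -/
noncomputable def recoveryProb (r : ℕ) (ε : ℝ) {n M : ℕ} (c : Equiv.Perm (Fin (2 ^ n)))
    (hM : M ≤ 2 ^ n) : ℝ :=
  1 - blockErrorProb r ε c hM

/-- The throughput `T = G * P_u` in packets per slot, with offered load `G = M / N`, `N = 2 ^ n`. -/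
noncomputable def throughput (r : ℕ) (ε : ℝ) {n M : ℕ} (c : Equiv.Perm (Fin (2 ^ n)))
    (hM : M ≤ 2 ^ n) : ℝ :=
  (M : ℝ) / 2 ^ n * recoveryProb r ε c hM

/-- The maximum throughput with `2 ^ n` slots, over the number `M ≤ 2 ^ n` of active users. -/
noncomputable def maxThroughput (r : ℕ) (ε : ℝ) {n : ℕ} (c : Equiv.Perm (Fin (2 ^ n))) : ℝ :=
  Finset.univ.sup' Finset.univ_nonempty
    fun M : Fin (2 ^ n + 1) => throughput r ε c (Nat.lt_succ_iff.mp M.isLt)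

end PSA

namespace PSA

/-! ### Encoding and decoding -/

/-! Sending is polar encoding of the source vector padded with zeros, and decoding depends only on
the erasure pattern. All packets are recovered exactly when the genie-aided pattern `erased`
vanishes on the information set (`pSC_eq_iff`): as long as earlier estimates are right, `⋆` and `g`
combine the erasure flags by "or" and "and".

Converse: "or" and "and" preserve the total number of unerased flags, so recovering M packets needs
M unerased slots. Taking expectations bounds the throughput by 1 - ε for every n (`throughput_le`).

Achievability: the erasure probabilities of the synthetic channels arise from ε by z ↦ 2z - z² and z
↦ z², and the SPA-v metric is r(1 - z), so SPA-v selects the most reliable channels. It then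
suffices that all but a fraction ε + o(1) of the channels have z ≤ 4⁻ⁿ
(`eventually_polarAvg_indicator_le`), for the union bound over at most 2ⁿ users gives error at most
2⁻ⁿ.

That rate of polarization comes in two stages. The mean of √(z(1-z)) shrinks by √3/2 per step while
the mean of z stays fixed, so after m steps most channels are nearly perfect or nearly useless, and
the fraction not nearly perfect is about ε at most. From a small z, a short second stage keeps z
small, so each squaring gains a large factor, and Markov's inequality for a small power of z yields
the threshold 4⁻ⁿ. -/

theorem sum_halves {A : Type*} [AddCommMonoid A] {n : ℕ} (f : Fin (2 ^ (n + 1)) → A) :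
    ∑ i, f i = ∑ k, f (halves n (0, k)) + ∑ k, f (halves n (1, k)) := by
  rw [← (halves n).sum_comp, Fintype.sum_prod_type, Fin.sum_univ_two]

theorem prod_halves {A : Type*} [CommMonoid A] {n : ℕ} (f : Fin (2 ^ (n + 1)) → A) :
    ∏ i, f i = ∏ k, f (halves n (0, k)) * f (halves n (1, k)) := by
  rw [← (halves n).prod_comp, Fintype.prod_prod_type, Fin.prod_univ_two, Finset.prod_mul_distrib]

theorem forall_halves {n : ℕ} {p : Fin (2 ^ (n + 1)) → Prop} :
    (∀ i, p i) ↔ (∀ k, p (halves n (0, k))) ∧ ∀ k, p (halves n (1, k)) := by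
  rw [← (halves n).forall_congr_right, Prod.forall, Fin.forall_fin_two]

theorem halves_val {n : ℕ} (b : Fin 2) (k : Fin (2 ^ n)) :
    (halves n (b, k) : ℕ) = b * 2 ^ n + k := by
  simp [halves, finProdFinEquiv]; ring

/-- The polar transform of a vector of packets. -/
def encode {r : ℕ} (n : ℕ) (u : Fin (2 ^ n) → Packet r) (k : Fin (2 ^ n)) : Packet r :=
  ∑ i, polarMatrix n i k • u i

theorem encode_zero {r : ℕ} (u : Fin (2 ^ 0) → Packet r) : encode 0 u = u := by
  funext k
  rw [encode, Fintype.sum_eq_single k fun i hi =>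
    absurd (Subsingleton.elim (α := Fin 1) i k) hi]
  simp [polarMatrix, Matrix.one_apply_eq]

theorem encode_succ_fst {r n : ℕ} (u : Fin (2 ^ (n + 1)) → Packet r) (k : Fin (2 ^ n)) :
    encode (n + 1) u (halves n (0, k)) =
      encode n (fun j => u (halves n (0, j))) k + encode n (fun j => u (halves n (1, j))) k := by
  simp [encode, sum_halves, polarMatrix, kernelF2]

theorem encode_succ_snd {r n : ℕ} (u : Fin (2 ^ (n + 1)) → Packet r) (k : Fin (2 ^ n)) :
    encode (n + 1) u (halves n (1, k)) = encode n (fun j => u (halves n (1, j))) k := by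
  simp [encode, sum_halves, polarMatrix, kernelF2]

theorem reencode_known {r : ℕ} : ∀ (n : ℕ) (u : Fin (2 ^ n) → Packet r),
    reencode n (fun k => known (u k)) = fun k => known (encode n u k)
  | 0, u => by simp [reencode, encode_zero]
  | n + 1, u => by
    rw [funext_iff, forall_halves]
    constructor <;> intro k
    · simp only [reencode, reencode_known n, Equiv.symm_apply_apply, encode_succ_fst]
      simp [starOp, known, funext_iff]
    · simp only [reencode, reencode_known n, Equiv.symm_apply_apply, encode_succ_snd]
      simp

/-- The genie-aided erasure pattern: which source packets stay erased when the slots marked by `e`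
are erased and all earlier source packets are known. -/
def erased : (n : ℕ) → (Fin (2 ^ n) → Bool) → Fin (2 ^ n) → Bool
  | 0, e => e
  | n + 1, e => fun i =>
    let p := (halves n).symm i
    if p.1 = 0 then erased n (fun k => e (halves n (0, k)) || e (halves n (1, k))) p.2
    else erased n (fun k => e (halves n (0, k)) && e (halves n (1, k))) p.2

theorem erased_fst {n : ℕ} (e : Fin (2 ^ (n + 1)) → Bool) (k : Fin (2 ^ n)) :
    erased (n + 1) e (halves n (0, k)) =
      erased n (fun k => e (halves n (0, k)) || e (halves n (1, k))) k := by
  simp [erased]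

theorem erased_snd {n : ℕ} (e : Fin (2 ^ (n + 1)) → Bool) (k : Fin (2 ^ n)) :
    erased (n + 1) e (halves n (1, k)) =
      erased n (fun k => e (halves n (0, k)) && e (halves n (1, k))) k := by
  simp [erased]

/-- Polarization conserves the number of packets that are not erased. -/
theorem sum_not_erased : ∀ (n : ℕ) (e : Fin (2 ^ n) → Bool),
    ∑ i, (if erased n e i then 0 else 1 : ℝ) = ∑ k, (if e k then 0 else 1 : ℝ)
  | 0, e => rfl
  | n + 1, e => by
    simp only [sum_halves, erased_fst, erased_snd, sum_not_erased n]
    -- Slot by slot, a pair of flags and the pair (or, and) have the same number of false entries.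
    rw [← Finset.sum_add_distrib, ← Finset.sum_add_distrib]
    refine Finset.sum_congr rfl fun k _ => ?_
    cases e (halves n (0, k)) <;> cases e (halves n (1, k)) <;> simp

/-- The packet `x` after a channel use which erases it if `b` holds. -/
def erasePacket {r : ℕ} (b : Bool) (x : Packet r) : EPacket r :=
  if b then fun _ => none else known x

theorem starOp_erasePacket {r : ℕ} (a b : Bool) (x y : Packet r) :
    starOp (erasePacket a (x + y)) (erasePacket b y) = erasePacket (a || b) x := by
  funext w
  cases a <;> cases b <;> simp [starOp, erasePacket, known, add_assoc, CharTwo.add_self_eq_zero]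

/-- With a correct estimate the two observations agree, so the contradiction branch of `gBit` is
never taken and either one alone determines `y`. -/
theorem gOp_erasePacket {r : ℕ} (a b : Bool) (x y : Packet r) :
    gOp (known x) (erasePacket a (x + y)) (erasePacket b y) = erasePacket (a && b) y := by
  funext w
  have h : x w + y w + x w = y w := by
    rw [add_comm (x w), add_assoc, CharTwo.add_self_eq_zero, add_zero]
  cases a <;> cases b <;> simp [gOp, gBit, erasePacket, known, h]

theorem pSC_of_notMem {r : ℕ} : ∀ (n : ℕ) (I : Finset (Fin (2 ^ n)))
    (y : Fin (2 ^ n) → EPacket r) (i : Fin (2 ^ n)), i ∉ I → pSC n I y i = known 0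
  | 0, I, y => fun i hi => by simp [pSC, hi]
  | n + 1, I, y => by
    rw [forall_halves]
    constructor <;> intro k hk <;> simp only [pSC, Equiv.symm_apply_apply]
    · exact pSC_of_notMem n _ _ k (by simpa using hk)
    · exact pSC_of_notMem n _ _ k (by simpa using hk)

/-- The decoder recovers all source packets exactly if no information packet is erased in the
genie-aided sense. -/
theorem pSC_eq_iff {r : ℕ} (hr : 0 < r) : ∀ (n : ℕ) (I : Finset (Fin (2 ^ n)))
    (e : Fin (2 ^ n) → Bool) (u : Fin (2 ^ n) → Packet r), (∀ i, i ∉ I → u i = 0) →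
    ((pSC n I fun k => erasePacket (e k) (encode n u k)) = (fun i => known (u i)) ↔
      ∀ i, i ∈ I → erased n e i = false)
  | 0, I, e, u, hu => by
    rw [funext_iff]
    simp only [encode_zero, pSC, erased]
    refine forall_congr' fun i => ?_
    by_cases hi : i ∈ I
    · cases h : e i
      · simp [hi, erasePacket]
      · simp [hi, erasePacket, known, funext_iff]
        -- A packet of length 0 would count as known even when erased; a component is needed to tell
        -- the two apart.
        exact ⟨⟨0, hr⟩⟩
    · simp [hi, hu i hi]
  | n + 1, I, e, u, hu => by
    have h0 := pSC_eq_iff hr n {k | halves n (0, k) ∈ I}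
      (fun k => e (halves n (0, k)) || e (halves n (1, k)))
      (fun k => u (halves n (0, k))) (fun k hk => hu _ (by simpa using hk))
    have h1 := pSC_eq_iff hr n {k | halves n (1, k) ∈ I}
      (fun k => e (halves n (0, k)) && e (halves n (1, k)))
      (fun k => u (halves n (1, k))) (fun k hk => hu _ (by simpa using hk))
    rw [forall_halves, funext_iff, forall_halves]
    simp only [erased_fst, erased_snd, pSC, Equiv.symm_apply_apply, encode_succ_fst,
      encode_succ_snd, starOp_erasePacket]
    simp only [if_true, one_ne_zero, if_false, ← funext_iff (β := fun _ => EPacket r)]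
    simp only [Finset.mem_filter, Finset.mem_univ, true_and] at h0 h1
    rw [← h0, ← h1]
    -- The second half only has to be compared when the first is correct, and then the re-encoded
    -- estimates are the true ones.
    refine and_congr_right fun h => ?_
    rw [h, reencode_known]
    simp only [gOp_erasePacket]

/-! ### Polarization of the erasure probability -/

/-- The average of `h` over the erasure probabilities of the `2 ^ n` synthetic channels of a
binary erasure channel with erasure probability `z`. -/
noncomputable def polarAvg : ℕ → (ℝ → ℝ) → ℝ → ℝ
  | 0, h, z => h z
  | n + 1, h, z => (polarAvg n h (2 * z - z ^ 2) + polarAvg n h (z ^ 2)) / 2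

theorem polarAvg_add_steps (k : ℕ) (h : ℝ → ℝ) : ∀ (m : ℕ) (z : ℝ),
    polarAvg (m + k) h z = polarAvg m (polarAvg k h) z
  | 0, z => by simp [polarAvg]
  | m + 1, z => by
    rw [Nat.add_right_comm]
    simp only [polarAvg, polarAvg_add_steps k h m]

theorem minus_mem {z : ℝ} (hz : z ∈ Set.Icc (0 : ℝ) 1) : 2 * z - z ^ 2 ∈ Set.Icc (0 : ℝ) 1 := by
  obtain ⟨h0, h1⟩ := hz
  constructor <;> nlinarith [sq_nonneg (1 - z)]

theorem plus_mem {z : ℝ} (hz : z ∈ Set.Icc (0 : ℝ) 1) : z ^ 2 ∈ Set.Icc (0 : ℝ) 1 := by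
  obtain ⟨h0, h1⟩ := hz
  constructor <;> nlinarith

theorem polarAvg_mono {h g : ℝ → ℝ} (hg : ∀ z ∈ Set.Icc (0 : ℝ) 1, h z ≤ g z) :
    ∀ (n : ℕ) (z : ℝ), z ∈ Set.Icc (0 : ℝ) 1 → polarAvg n h z ≤ polarAvg n g z
  | 0, z, hz => hg z hz
  | n + 1, z, hz => by
    have h1 := polarAvg_mono hg n _ (minus_mem hz)
    have h2 := polarAvg_mono hg n _ (plus_mem hz)
    simp only [polarAvg]
    linarith

/-- The erasure probability is a martingale: 2z - z² and z² average to z. -/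
theorem polarAvg_id_add_const_add_mul (a C : ℝ) (f : ℝ → ℝ) : ∀ (n : ℕ) (z : ℝ),
    polarAvg n (fun z => z + a + C * f z) z = z + a + C * polarAvg n f z
  | 0, z => rfl
  | n + 1, z => by
    simp only [polarAvg, polarAvg_id_add_const_add_mul a C f n]
    ring

theorem polarAvg_const_mul (C : ℝ) (f : ℝ → ℝ) : ∀ (n : ℕ) (z : ℝ),
    polarAvg n (fun z => C * f z) z = C * polarAvg n f z
  | 0, z => rfl
  | n + 1, z => by
    simp only [polarAvg, polarAvg_const_mul C f n]
    ring

theorem polarAvg_const (C : ℝ) : ∀ (n : ℕ) (z : ℝ), polarAvg n (fun _ => C) z = C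
  | 0, z => rfl
  | n + 1, z => by
    simp only [polarAvg, polarAvg_const C n]
    ring

/-- AM-GM weighted to be sharp at b = 3a, the ratio met at z = 1/2 in both terms of
`sqrt_polar_step`; there the two bounds add up to √3 for every z. -/
theorem sqrt_mul_le_weighted {a b : ℝ} (ha : 0 ≤ a) (hb : 0 ≤ b) :
    √(a * b) ≤ (√3 * a + b / √3) / 2 := by
  have h3 : 0 < √(3 : ℝ) := by positivity
  apply Real.sqrt_le_iff.2
  refine ⟨by positivity, ?_⟩
  have : a * b = (√3 * a) * (b / √3) := by field_simp
  rw [this]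
  nlinarith [sq_nonneg (√3 * a - b / √3)]

theorem sqrt_polar_step {z : ℝ} (hz : z ∈ Set.Icc (0 : ℝ) 1) :
    (√((2 * z - z ^ 2) * (1 - (2 * z - z ^ 2))) + √(z ^ 2 * (1 - z ^ 2))) / 2 ≤
      √3 / 2 * √(z * (1 - z)) := by
  obtain ⟨h0, h1⟩ := hz
  have e1 : √((2 * z - z ^ 2) * (1 - (2 * z - z ^ 2))) =
      √(z * (1 - z)) * √((1 - z) * (2 - z)) := by
    rw [← Real.sqrt_mul (by nlinarith)]; congr 1; ring
  have e2 : √(z ^ 2 * (1 - z ^ 2)) = √(z * (1 - z)) * √(z * (1 + z)) := by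
    rw [← Real.sqrt_mul (by nlinarith)]; congr 1; ring
  have b1 := sqrt_mul_le_weighted (a := 1 - z) (b := 2 - z) (by linarith) (by linarith)
  have b2 := sqrt_mul_le_weighted (a := z) (b := 1 + z) (by linarith) (by linarith)
  have h3 : √(3 : ℝ) * √3 = 3 := Real.mul_self_sqrt (by norm_num)
  have hp : 0 < √(3 : ℝ) := by positivity
  have e3 : (√3 * (1 - z) + (2 - z) / √3) / 2 + (√3 * z + (1 + z) / √3) / 2 = √3 := by
    field_simp; nlinarith
  have hs : 0 ≤ √(z * (1 - z)) := Real.sqrt_nonneg _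
  rw [e1, e2]
  nlinarith

theorem polarAvg_sqrt_le : ∀ (n : ℕ) (z : ℝ), z ∈ Set.Icc (0 : ℝ) 1 →
    polarAvg n (fun z => √(z * (1 - z))) z ≤ (√3 / 2) ^ n * √(z * (1 - z))
  | 0, z, _ => by simp [polarAvg]
  | n + 1, z, hz => by
    have h1 := polarAvg_sqrt_le n _ (minus_mem hz)
    have h2 := polarAvg_sqrt_le n _ (plus_mem hz)
    have h3 := mul_le_mul_of_nonneg_left (sqrt_polar_step hz)
      (show (0 : ℝ) ≤ (√3 / 2) ^ n by positivity)
    simp only [polarAvg]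
    rw [pow_succ _ n]
    linarith

/-- A step at most doubles z, so z * 2 ^ n ≤ s keeps z ≤ s throughout. Hence a plus step multiplies
z by at most s and a minus step by at most 2. -/
theorem polarAvg_rpow_le {α s : ℝ} (hα : 0 ≤ α) (hs : s ≤ 1) : ∀ (n : ℕ) (z : ℝ), 0 ≤ z →
    z * 2 ^ n ≤ s → polarAvg n (fun z => z ^ α) z ≤ ((s ^ α + 2 ^ α) / 2) ^ n * z ^ α
  | 0, z, _, _ => by simp [polarAvg]
  | n + 1, z, h0, hzs => by
    have hp : (1 : ℝ) ≤ 2 ^ n := one_le_pow₀ (by norm_num)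
    have hz2 : z * 2 * 2 ^ n ≤ s := by rw [pow_succ] at hzs; linarith
    have hz : z ≤ s := by nlinarith
    have h1 := polarAvg_rpow_le hα hs n (2 * z - z ^ 2) (by nlinarith) (by nlinarith [sq_nonneg z])
    have h2 := polarAvg_rpow_le hα hs n (z ^ 2) (by positivity) (by nlinarith)
    have s0 : 0 ≤ s := h0.trans hz
    have e1 : (2 * z - z ^ 2) ^ α ≤ 2 ^ α * z ^ α := by
      rw [← Real.mul_rpow (by norm_num) h0]
      exact Real.rpow_le_rpow (by nlinarith) (by nlinarith [sq_nonneg z]) hα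
    have e2 : (z ^ 2) ^ α ≤ s ^ α * z ^ α := by
      rw [← Real.mul_rpow s0 h0]
      exact Real.rpow_le_rpow (by positivity) (by nlinarith) hα
    have h3 := mul_le_mul_of_nonneg_left (add_le_add e1 e2)
      (show (0 : ℝ) ≤ ((s ^ α + 2 ^ α) / 2) ^ n by positivity)
    simp only [polarAvg]
    rw [pow_succ _ n]
    linarith

/-- For z > s, write 1 = z + (1 - z) and use 1 - z ≤ √(1 - z) ≤ √(1 - z) √z / √s. The summand z
keeps its mean and the other one decays under polarization. -/
theorem indicator_lt_le {s z : ℝ} (hs : 0 < s) (hz : z ∈ Set.Icc (0 : ℝ) 1) :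
    (if s < z then 1 else 0 : ℝ) ≤ z + (√s)⁻¹ * √(z * (1 - z)) := by
  obtain ⟨h0, h1⟩ := hz
  split_ifs with h
  · have h2 : √(1 - z) ≤ 1 := Real.sqrt_le_one.2 (by linarith)
    have h3 : 1 - z ≤ √(1 - z) := by
      nlinarith [Real.sq_sqrt (show 0 ≤ 1 - z by linarith), Real.sqrt_nonneg (1 - z)]
    have h4 : 1 ≤ (√s)⁻¹ * √z := by
      rw [inv_mul_eq_div, one_le_div (by positivity)]
      exact Real.sqrt_le_sqrt h.le
    rw [Real.sqrt_mul h0, ← mul_assoc]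
    nlinarith [Real.sqrt_nonneg (1 - z)]
  · have := Real.sqrt_nonneg (z * (1 - z))
    positivity

/-- Two-stage bound on the fraction of synthetic channels that are not almost noiseless. -/
theorem polarAvg_indicator_le {α t : ℝ} (hα : 0 ≤ α) (ht : 0 < t) (m k : ℕ) {z : ℝ}
    (hz : z ∈ Set.Icc (0 : ℝ) 1) :
    polarAvg (m + k) (fun z => if t < z then 1 else 0) z ≤
      z + (t ^ α)⁻¹ * (((2 ^ k)⁻¹ ^ α + 2 ^ α) / 2) ^ k + 2 ^ k * (√3 / 2) ^ m := by
  set D : ℝ := (t ^ α)⁻¹ * (((2 ^ k)⁻¹ ^ α + 2 ^ α) / 2) ^ k with hD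
  have hD0 : 0 ≤ D := by positivity
  have hs : (0 : ℝ) < (2 ^ k)⁻¹ ^ 2 := by positivity
  have inner : ∀ z ∈ Set.Icc (0 : ℝ) 1, polarAvg k (fun z => if t < z then 1 else 0) z ≤
      z + D + 2 ^ k * √(z * (1 - z)) := by
    intro z hz
    -- Below 4⁻ᵏ, k doublings still leave z ≤ 2⁻ᵏ, as `polarAvg_rpow_le` needs; above it the trivial
    -- bound 1 is charged to the first stage.
    by_cases h : (2 ^ k : ℝ)⁻¹ ^ 2 < z
    · have h1 := indicator_lt_le hs hz
      rw [if_pos h, Real.sqrt_sq (by positivity), inv_inv] at h1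
      have h2 : polarAvg k (fun z => if t < z then 1 else 0) z ≤ polarAvg k (fun _ => 1) z :=
        polarAvg_mono (fun z _ => by split_ifs <;> norm_num) k z hz
      rw [polarAvg_const] at h2
      linarith
    · have h1 : polarAvg k (fun z => if t < z then 1 else 0) z ≤
          polarAvg k (fun z => (t ^ α)⁻¹ * z ^ α) z := by
        refine polarAvg_mono (fun z hz => ?_) k z hz
        split_ifs with hlt
        · rw [inv_mul_eq_div, one_le_div (by positivity)]
          exact Real.rpow_le_rpow ht.le hlt.le hα
        · have := Real.rpow_nonneg hz.1 α
          positivity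
      rw [polarAvg_const_mul] at h1
      have h2 := polarAvg_rpow_le (s := (2 ^ k : ℝ)⁻¹) hα
        (inv_le_one_of_one_le₀ (one_le_pow₀ (by norm_num))) k z hz.1 (by
          have : (2 ^ k : ℝ)⁻¹ = (2 ^ k : ℝ)⁻¹ ^ 2 * 2 ^ k := by field_simp
          rw [this]
          exact mul_le_mul_of_nonneg_right (not_lt.1 h) (by positivity))
      have h3 : z ^ α ≤ 1 := Real.rpow_le_one hz.1 hz.2 hα
      have h4 : polarAvg k (fun z => z ^ α) z ≤ (((2 ^ k : ℝ)⁻¹ ^ α + 2 ^ α) / 2) ^ k :=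
        h2.trans (mul_le_of_le_one_right (by positivity) h3)
      have h5 := mul_le_mul_of_nonneg_left h4 (show 0 ≤ (t ^ α)⁻¹ by positivity)
      have h6 : (0 : ℝ) ≤ 2 ^ k * √(z * (1 - z)) := by positivity
      linarith [hz.1]
  rw [polarAvg_add_steps]
  refine (polarAvg_mono inner m z hz).trans ?_
  rw [polarAvg_id_add_const_add_mul]
  have h1 := polarAvg_sqrt_le m z hz
  have h2 : √(z * (1 - z)) ≤ 1 := Real.sqrt_le_one.2 (by nlinarith [hz.1, hz.2])
  have h3 : polarAvg m (fun z => √(z * (1 - z))) z ≤ (√3 / 2) ^ m :=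
    h1.trans (mul_le_of_le_one_right (by positivity) h2)
  have h4 := mul_le_mul_of_nonneg_left h3 (show (0 : ℝ) ≤ 2 ^ k by positivity)
  linarith

open Filter Topology in
/-- The fraction of synthetic channels with erasure probability above `4 ^ (-n)` is asymptotically
at most the erasure probability. -/
theorem eventually_polarAvg_indicator_le {z η : ℝ} (hz : z ∈ Set.Icc (0 : ℝ) 1) (hη : 0 < η) :
    ∀ᶠ n : ℕ in atTop, polarAvg n (fun z => if (4 ^ n : ℝ)⁻¹ < z then 1 else 0) z ≤ z + η := by
  -- The exponent 1/64 makes b¹⁵ / 2 < 9/10: the Markov factor b ^ (2 * n), about b¹⁴ per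
  -- second-stage step, is then beaten by the contraction, which tends to b / 2.
  set b : ℝ := 2 ^ (1 / 64 : ℝ) with hb
  have hb0 : 0 < b := by positivity
  have hb64 : b ^ 64 = 2 := by
    rw [hb, ← Real.rpow_natCast, ← Real.rpow_mul (by norm_num)]; norm_num
  have hb1 : 1 < b := by
    by_contra h
    have := pow_le_one₀ hb0.le (not_lt.1 h) (n := 64)
    linarith
  have hb2 : b < 1.02 := by
    by_contra h
    have := pow_le_pow_left₀ (by norm_num) (not_lt.1 h) 64
    rw [hb64] at this
    norm_num at this
  have hpow : ∀ k : ℕ, ((2 : ℝ) ^ k) ^ (1 / 64 : ℝ) = b ^ k := fun k => by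
    rw [hb, ← Real.rpow_natCast, ← Real.rpow_natCast, ← Real.rpow_mul (by norm_num),
      ← Real.rpow_mul (by norm_num), mul_comm]
  have lim1 : Tendsto (fun k : ℕ => ((b⁻¹ ^ k + b) / 2 * b ^ 14)) atTop
      (𝓝 ((0 + b) / 2 * b ^ 14)) :=
    (((tendsto_pow_atTop_nhds_zero_of_lt_one (by positivity)
      (inv_lt_one_of_one_lt₀ hb1)).add_const b).div_const 2).mul_const _
  have hlt : (0 + b) / 2 * b ^ 14 < 9 / 10 := by
    have := pow_le_pow_left₀ hb0.le hb2.le 15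
    have h : (0 + b) / 2 * b ^ 14 = b ^ 15 / 2 := by ring
    rw [h]
    norm_num at this ⊢
    linarith
  have lim2 : Tendsto (fun k : ℕ => b ^ 12 * (9 / 10 : ℝ) ^ k + (27 / 32 : ℝ) ^ k) atTop
      (𝓝 (b ^ 12 * 0 + 0)) :=
    ((tendsto_pow_atTop_nhds_zero_of_lt_one (by norm_num) (by norm_num)).const_mul _).add
      (tendsto_pow_atTop_nhds_zero_of_lt_one (by norm_num) (by norm_num))
  have ev := (lim1.eventually (gt_mem_nhds hlt)).and
    (lim2.eventually (gt_mem_nhds (show b ^ 12 * 0 + 0 < η by simpa using hη)))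
  have hdiv : Tendsto (fun n : ℕ => n / 7) atTop atTop :=
    Nat.tendsto_div_const_atTop (by norm_num)
  filter_upwards [hdiv.eventually ev] with n hn
  -- With at least 6k first-stage steps, the loss 2ᵏ is absorbed: 2 · (√3/2)⁶ = 27/32 < 1.
  set k := n / 7 with hk
  obtain ⟨m, hm⟩ : ∃ m, n = m + k := ⟨n - k, by omega⟩
  have hmk : 6 * k ≤ m := by omega
  have hnk : n ≤ 7 * k + 6 := by omega
  have key := polarAvg_indicator_le (α := 1 / 64) (t := (4 ^ n : ℝ)⁻¹) (by norm_num)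
    (by positivity) m k hz
  rw [← hm] at key
  refine key.trans ?_
  have e1 : (((4 ^ n : ℝ)⁻¹) ^ (1 / 64 : ℝ))⁻¹ = b ^ (2 * n) := by
    rw [Real.inv_rpow (by positivity), inv_inv, ← hpow, pow_mul]; norm_num
  have e2 : ((2 ^ k : ℝ)⁻¹) ^ (1 / 64 : ℝ) = b⁻¹ ^ k := by
    rw [Real.inv_rpow (by positivity), hpow, inv_pow]
  rw [e1, e2]
  have h1 : b ^ (2 * n) * ((b⁻¹ ^ k + b) / 2) ^ k ≤ b ^ 12 * (9 / 10 : ℝ) ^ k := by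
    calc b ^ (2 * n) * ((b⁻¹ ^ k + b) / 2) ^ k
        ≤ b ^ (14 * k + 12) * ((b⁻¹ ^ k + b) / 2) ^ k :=
          mul_le_mul_of_nonneg_right (pow_le_pow_right₀ hb1.le (by omega)) (by positivity)
      _ = b ^ 12 * ((b⁻¹ ^ k + b) / 2 * b ^ 14) ^ k := by
          rw [mul_pow, ← pow_mul b 14]; ring
      _ ≤ _ := mul_le_mul_of_nonneg_left
          (pow_le_pow_left₀ (by positivity) hn.1.le k) (by positivity)
  have h2 : (2 : ℝ) ^ k * (√3 / 2) ^ m ≤ (27 / 32 : ℝ) ^ k := by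
    have h3 : √(3 : ℝ) ^ 2 = 3 := Real.sq_sqrt (by norm_num)
    have h4 : √(3 : ℝ) / 2 ≤ 1 := by nlinarith [Real.sqrt_nonneg (3 : ℝ)]
    have h5 : (√(3 : ℝ) / 2) ^ 6 = 27 / 64 := by
      rw [div_pow, show (6 : ℕ) = 2 * 3 from rfl, pow_mul √(3 : ℝ), h3]; norm_num
    calc (2 : ℝ) ^ k * (√3 / 2) ^ m ≤ 2 ^ k * (√3 / 2) ^ (6 * k) :=
          mul_le_mul_of_nonneg_left (pow_le_pow_of_le_one (by positivity) h4 hmk) (by positivity)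
      _ = (27 / 32 : ℝ) ^ k := by rw [pow_mul, h5, ← mul_pow]; norm_num
  have hn2 : b ^ 12 * (9 / 10 : ℝ) ^ k + (27 / 32 : ℝ) ^ k < η := hn.2
  linarith

/-! ### Erasure probabilities of the synthetic channels -/

/-- A coordinatewise map sends a product weight to the product of the pushed-forward weights; group
the sum by fibres. -/
theorem sum_prod_comp {ι α β : Type*} [Fintype ι] [DecidableEq ι] [Fintype α] [Fintype β]
    [DecidableEq β] (p : α → ℝ) (op : α → β) (h : (ι → β) → ℝ) :
    ∑ e : ι → α, (∏ k, p (e k)) * h (fun k => op (e k)) =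
      ∑ e' : ι → β, (∏ k, ∑ a with op a = e' k, p a) * h e' := by
  classical
  rw [← Finset.sum_fiberwise (g := fun (e : ι → α) k => op (e k))]
  refine Finset.sum_congr rfl fun e' _ => ?_
  rw [Finset.prod_univ_sum, Finset.sum_mul]
  refine Finset.sum_congr ?_ fun e he => ?_
  · ext e
    simp [funext_iff]
  · have : (fun k => op (e k)) = e' := by simpa [funext_iff] using he
    rw [this]

/-- Probability of the erasure pattern `e` in independent uses of an erasure channel. -/
noncomputable def patternProb {n : ℕ} (z : ℝ) (e : Fin (2 ^ n) → Bool) : ℝ :=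
  ∏ k, if e k then z else 1 - z

theorem patternProb_nonneg {n : ℕ} {z : ℝ} (hz : z ∈ Set.Icc (0 : ℝ) 1)
    (e : Fin (2 ^ n) → Bool) : 0 ≤ patternProb z e :=
  Finset.prod_nonneg fun k _ => by split_ifs <;> linarith [hz.1, hz.2]

theorem sum_patternProb (n : ℕ) (z : ℝ) : ∑ e : Fin (2 ^ n) → Bool, patternProb z e = 1 := by
  have h := Finset.prod_univ_sum (fun _ : Fin (2 ^ n) => (Finset.univ : Finset Bool))
    (fun _ b => if b then z else 1 - z)
  rw [Fintype.piFinset_univ] at h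
  simp only [patternProb, ← h]
  simp

/-- A pattern on the slots of both halves as a pattern of pairs. -/
def pairHalves (n : ℕ) : (Fin (2 ^ (n + 1)) → Bool) ≃ (Fin (2 ^ n) → Bool × Bool) where
  toFun e k := (e (halves n (0, k)), e (halves n (1, k)))
  invFun f i := if ((halves n).symm i).1 = 0 then (f ((halves n).symm i).2).1
    else (f ((halves n).symm i).2).2
  left_inv e := by rw [funext_iff, forall_halves]; simp
  right_inv f := by funext k; simp

theorem sum_patternProb_succ {n : ℕ} (z z' : ℝ) (op : Bool × Bool → Bool)
    (hop : ∀ b, (∑ a with op a = b, (if a.1 then z else 1 - z) * (if a.2 then z else 1 - z)) =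
      if b then z' else 1 - z') (h : (Fin (2 ^ n) → Bool) → ℝ) :
    ∑ e : Fin (2 ^ (n + 1)) → Bool,
        patternProb z e * h (fun k => op (e (halves n (0, k)), e (halves n (1, k)))) =
      ∑ e : Fin (2 ^ n) → Bool, patternProb z' e * h e := by
  have := sum_prod_comp (ι := Fin (2 ^ n))
    (fun a : Bool × Bool => (if a.1 then z else 1 - z) * (if a.2 then z else 1 - z)) op h
  simp only [hop] at this
  rw [← (pairHalves n).sum_comp] at this
  simp only [patternProb, prod_halves]
  convert this <;> rfl

theorem sum_patternProb_or {n : ℕ} (z : ℝ) (h : (Fin (2 ^ n) → Bool) → ℝ) :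
    ∑ e : Fin (2 ^ (n + 1)) → Bool,
        patternProb z e * h (fun k => e (halves n (0, k)) || e (halves n (1, k))) =
      ∑ e : Fin (2 ^ n) → Bool, patternProb (2 * z - z ^ 2) e * h e := by
  refine sum_patternProb_succ z _ (fun a => a.1 || a.2) (fun b => ?_) h
  cases b <;> simp [Finset.sum_filter, Fintype.sum_prod_type] <;> ring

theorem sum_patternProb_and {n : ℕ} (z : ℝ) (h : (Fin (2 ^ n) → Bool) → ℝ) :
    ∑ e : Fin (2 ^ (n + 1)) → Bool,
        patternProb z e * h (fun k => e (halves n (0, k)) && e (halves n (1, k))) =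
      ∑ e : Fin (2 ^ n) → Bool, patternProb (z ^ 2) e * h e := by
  refine sum_patternProb_succ z _ (fun a => a.1 && a.2) (fun b => ?_) h
  cases b <;> simp [Finset.sum_filter, Fintype.sum_prod_type] <;> ring

/-- The metric recurses on the lowest index bit, the last polarization step, whereas `halves` splits
by the highest bit, the first step. This and `capacityMetric_snd` move the recursion to the other
end. -/
theorem capacityMetric_fst {r : ℕ} (hr : 0 < r) (z : ℝ) : ∀ (n j : ℕ), j < 2 ^ n →
    capacityMetric r z (n + 1) j = capacityMetric r (2 * z - z ^ 2) n j
  | 0, j, hj => by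
    obtain rfl : j = 0 := by simpa using hj
    have : (r : ℝ) ≠ 0 := by positivity
    simp [capacityMetric]; field_simp; ring
  | n + 1, j, hj => by
    rw [capacityMetric, capacityMetric_fst hr z n (j / 2) (by rw [pow_succ] at hj; omega)]
    rfl

theorem capacityMetric_snd {r : ℕ} (hr : 0 < r) (z : ℝ) : ∀ (n j : ℕ), j < 2 ^ n →
    capacityMetric r z (n + 1) (2 ^ n + j) = capacityMetric r (z ^ 2) n j
  | 0, j, hj => by
    obtain rfl : j = 0 := by simpa using hj
    have : (r : ℝ) ≠ 0 := by positivity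
    simp [capacityMetric]; field_simp; ring
  | n + 1, j, hj => by
    have h1 : (2 ^ (n + 1) + j) / 2 = 2 ^ n + j / 2 := by rw [pow_succ]; omega
    have h2 : (2 ^ (n + 1) + j) % 2 = j % 2 := by rw [pow_succ]; omega
    rw [capacityMetric, h1, h2,
      capacityMetric_snd hr z n (j / 2) (by rw [pow_succ] at hj; omega)]
    rfl

/-- Erasure probability of a synthetic channel, from its capacity metric. -/
noncomputable def erasureProb (r : ℕ) (z : ℝ) (n : ℕ) (i : Fin (2 ^ n)) : ℝ :=
  1 - capacityMetric r z n i / r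

theorem erasureProb_zero {r : ℕ} (hr : 0 < r) (z : ℝ) (i : Fin (2 ^ 0)) :
    erasureProb r z 0 i = z := by
  have : (r : ℝ) ≠ 0 := by positivity
  simp [erasureProb, capacityMetric]; field_simp; ring

theorem erasureProb_fst {r : ℕ} (hr : 0 < r) (z : ℝ) {n : ℕ} (k : Fin (2 ^ n)) :
    erasureProb r z (n + 1) (halves n (0, k)) = erasureProb r (2 * z - z ^ 2) n k := by
  simp [erasureProb, halves_val, capacityMetric_fst hr z n k k.isLt]

theorem erasureProb_snd {r : ℕ} (hr : 0 < r) (z : ℝ) {n : ℕ} (k : Fin (2 ^ n)) :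
    erasureProb r z (n + 1) (halves n (1, k)) = erasureProb r (z ^ 2) n k := by
  simp [erasureProb, halves_val, capacityMetric_snd hr z n k k.isLt]

theorem sum_patternProb_slot {n : ℕ} (z : ℝ) (k : Fin (2 ^ n)) :
    ∑ e : Fin (2 ^ n) → Bool, patternProb z e * (if e k then 0 else 1) = 1 - z := by
  -- The indicator is absorbed into the factor of slot k, so the weight is still a product.
  have h := Finset.prod_univ_sum (fun _ : Fin (2 ^ n) => (Finset.univ : Finset Bool))
    (fun j b => if j = k then (if b then 0 else 1 - z) else if b then z else 1 - z)
  rw [Fintype.piFinset_univ] at h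
  have hl : ∀ j : Fin (2 ^ n), (∑ b : Bool, if j = k then (if b then 0 else 1 - z)
      else if b then z else 1 - z) = if j = k then 1 - z else 1 := by
    intro j
    split_ifs <;> simp
  simp only [hl, Finset.prod_ite_eq', Finset.mem_univ, if_true] at h
  rw [h]
  refine Finset.sum_congr rfl fun e _ => ?_
  rw [patternProb, ← Finset.mul_prod_erase _ _ (Finset.mem_univ k),
    ← Finset.mul_prod_erase _ _ (Finset.mem_univ k)]
  have : ∏ x ∈ Finset.univ.erase k, (if x = k then (if e x then 0 else 1 - z)
      else if e x then z else 1 - z) = ∏ x ∈ Finset.univ.erase k, if e x then z else 1 - z :=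
    Finset.prod_congr rfl fun x hx => by rw [if_neg (Finset.ne_of_mem_erase hx)]
  rw [this]
  cases e k <;> simp

theorem sum_patternProb_erased {r : ℕ} (hr : 0 < r) : ∀ (n : ℕ) (z : ℝ) (i : Fin (2 ^ n)),
    ∑ e : Fin (2 ^ n) → Bool, patternProb z e * (if erased n e i then 1 else 0) =
      erasureProb r z n i
  | 0, z, i => by
    have h : ∑ e : Fin (2 ^ 0) → Bool, patternProb z e * (if erased 0 e i then 1 else 0) +
        ∑ e : Fin (2 ^ 0) → Bool, patternProb z e * (if e i then 0 else 1) = 1 := by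
      rw [← Finset.sum_add_distrib]
      refine (Finset.sum_congr rfl fun e _ => ?_).trans (sum_patternProb 0 z)
      rw [show erased 0 e i = e i from rfl]
      cases e i <;> simp
    rw [sum_patternProb_slot] at h
    rw [erasureProb_zero hr]
    linarith
  | n + 1, z, i => by
    revert i
    rw [forall_halves]
    constructor <;> intro k
    · simp only [erased_fst, erasureProb_fst hr]
      rw [← sum_patternProb_erased hr n]
      exact sum_patternProb_or z fun e => if erased n e k then 1 else 0
    · simp only [erased_snd, erasureProb_snd hr]
      rw [← sum_patternProb_erased hr n]
      exact sum_patternProb_and z fun e => if erased n e k then 1 else 0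

theorem sum_erasureProb {r : ℕ} (hr : 0 < r) (h : ℝ → ℝ) : ∀ (n : ℕ) (z : ℝ),
    ∑ i, h (erasureProb r z n i) = 2 ^ n * polarAvg n h z
  | 0, z => by
    simp only [erasureProb_zero hr]
    simp [polarAvg]
  | n + 1, z => by
    simp only [sum_halves, erasureProb_fst hr, erasureProb_snd hr, sum_erasureProb hr h n, polarAvg]
    ring

/-! ### The recovery probability -/

/-- The source packets: user `t` supplies the packet with index `rowIndex c hM t`. -/
def source {r n M : ℕ} (c : Equiv.Perm (Fin (2 ^ n))) (hM : M ≤ 2 ^ n)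
    (U : Fin M → Packet r) (i : Fin (2 ^ n)) : Packet r :=
  ∑ t, if rowIndex c hM t = i then U t else 0

theorem rowIndex_injective {n M : ℕ} (c : Equiv.Perm (Fin (2 ^ n))) (hM : M ≤ 2 ^ n) :
    Function.Injective (rowIndex c hM) := fun s t h => by
  simpa [rowIndex, Fin.ext_iff] using congrArg Fin.rev (Fin.castLE_injective hM (c.injective h))

theorem source_rowIndex {r n M : ℕ} (c : Equiv.Perm (Fin (2 ^ n))) (hM : M ≤ 2 ^ n)
    (U : Fin M → Packet r) (t : Fin M) : source c hM U (rowIndex c hM t) = U t := by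
  simp [source, (rowIndex_injective c hM).eq_iff]

theorem exists_rowIndex_eq_iff {n M : ℕ} (c : Equiv.Perm (Fin (2 ^ n))) (hM : M ≤ 2 ^ n)
    (i : Fin (2 ^ n)) : (∃ t, rowIndex c hM t = i) ↔ i ∈ infoSet c M := by
  constructor
  · rintro ⟨t, rfl⟩
    simp only [infoSet, rowIndex, Finset.mem_filter, Finset.mem_univ, true_and,
      Equiv.symm_apply_apply, Fin.val_castLE]
    exact t.rev.isLt
  · intro h
    simp only [infoSet, Finset.mem_filter, Finset.mem_univ, true_and] at h
    refine ⟨Fin.rev ⟨c.symm i, h⟩, ?_⟩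
    simp [rowIndex]

theorem source_of_notMem {r n M : ℕ} (c : Equiv.Perm (Fin (2 ^ n))) (hM : M ≤ 2 ^ n)
    (U : Fin M → Packet r) {i : Fin (2 ^ n)} (hi : i ∉ infoSet c M) : source c hM U i = 0 := by
  rw [← exists_rowIndex_eq_iff c hM, not_exists] at hi
  simp [source, hi]

theorem slotted_eq_encode {r n M : ℕ} (c : Equiv.Perm (Fin (2 ^ n))) (hM : M ≤ 2 ^ n)
    (U : Fin M → Packet r) : slotted c hM U = encode n (source c hM U) := by
  funext k
  simp only [slotted, encode, source, Finset.smul_sum, smul_ite, smul_zero]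
  rw [Finset.sum_comm]
  simp [slotPattern]

/-- Outside the information set the decoder always outputs the correct 0, so recovering all users is
recovering the whole source vector. -/
theorem isBlockError_iff {r n M : ℕ} (hr : 0 < r) (c : Equiv.Perm (Fin (2 ^ n)))
    (hM : M ≤ 2 ^ n) (U : Fin M → Packet r) (e : Fin (2 ^ n) → Bool) :
    IsBlockError c hM U (fun k => if e k then none else some (slotted c hM U k)) ↔
      ¬ ∀ i ∈ infoSet c M, erased n e i = false := by
  have hrec : (fun k => received (if e k then none else some (slotted c hM U k))) =
      fun k => erasePacket (e k) (encode n (source c hM U) k) := by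
    funext k
    rw [slotted_eq_encode]
    cases e k <;> simp [received, erasePacket]
  rw [← pSC_eq_iff hr n _ e _ fun i hi => source_of_notMem c hM U hi, IsBlockError, hrec,
    funext_iff, ← not_forall_not]
  simp only [not_not]
  refine not_congr ⟨fun h i => ?_, fun h t => by rw [h, source_rowIndex]⟩
  by_cases hi : i ∈ infoSet c M
  · obtain ⟨t, rfl⟩ := (exists_rowIndex_eq_iff c hM i).2 hi
    rw [h, source_rowIndex]
  · rw [pSC_of_notMem n _ _ i hi, source_of_notMem c hM U hi]

/-- The channel outputs of positive probability correspond to the erasure patterns. -/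
theorem sum_sec {r n : ℕ} (ε : ℝ) (X : Fin (2 ^ n) → Packet r)
    (h : (Fin (2 ^ n) → Option (Packet r)) → ℝ) :
    ∑ Y, (∏ k, sec ε (Y k) (X k)) * h Y =
      ∑ e : Fin (2 ^ n) → Bool, patternProb ε e * h fun k => if e k then none else some (X k) := by
  symm
  refine Finset.sum_of_injOn (fun e k => if e k then none else some (X k)) ?_ (by simp) ?_ ?_
  · intro e _ e' _ he
    funext k
    have := congrFun he k
    revert this
    dsimp only
    cases e k <;> cases e' k <;> simp
  · intro Y _ hY
    simp only [Finset.coe_univ, Set.image_univ, Set.mem_range, not_exists] at hY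
    -- If every factor is nonzero, each output is an erasure or the true packet, so `Y` comes from a
    -- pattern.
    have hex : ∃ k, sec ε (Y k) (X k) = 0 := by
      by_contra hcon
      push Not at hcon
      refine hY (fun k => (Y k).isNone) (funext fun k => ?_)
      have hk := hcon k
      cases hYk : Y k with
      | none => simp
      | some x =>
        rw [hYk] at hk
        have : x = X k := by by_contra hne; simp [sec, hne] at hk
        simp [this]
    obtain ⟨k, hk⟩ := hex
    rw [Finset.prod_eq_zero (Finset.mem_univ k) hk, zero_mul]
  · intro e _
    rw [patternProb]
    congr 1
    refine Finset.prod_congr rfl fun k _ => ?_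
    dsimp only
    cases e k <;> simp [sec]

/-- Given U, the error probability does not depend on U, so averaging over U is trivial. -/
theorem blockErrorProb_eq {r n M : ℕ} (hr : 0 < r) (ε : ℝ) (c : Equiv.Perm (Fin (2 ^ n)))
    (hM : M ≤ 2 ^ n) :
    blockErrorProb r ε c hM = ∑ e : Fin (2 ^ n) → Bool,
      patternProb ε e * (if ∀ i ∈ infoSet c M, erased n e i = false then 0 else 1) := by
  classical
  have h : ∀ U : Fin M → Packet r,
      (∑ Y : Fin (2 ^ n) → Option (Packet r), if IsBlockError c hM U Y then
        (1 / (2 : ℝ) ^ r) ^ M * ∏ k, sec ε (Y k) (slotted c hM U k) else 0) =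
      (1 / (2 : ℝ) ^ r) ^ M * ∑ e : Fin (2 ^ n) → Bool,
        patternProb ε e * (if ∀ i ∈ infoSet c M, erased n e i = false then 0 else 1) := by
    intro U
    have h1 := sum_sec ε (slotted c hM U) fun Y => if IsBlockError c hM U Y then 1 else 0
    simp only [isBlockError_iff hr, ite_not] at h1
    rw [← h1, Finset.mul_sum]
    refine Finset.sum_congr rfl fun Y _ => ?_
    split_ifs <;> simp
  rw [blockErrorProb, Finset.sum_congr rfl fun U _ => h U, Finset.sum_const, nsmul_eq_mul,
    ← mul_assoc]
  have : ((Finset.univ : Finset (Fin M → Packet r)).card : ℝ) * (1 / (2 : ℝ) ^ r) ^ M = 1 := by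
    simp
  rw [this, one_mul]

theorem recoveryProb_eq {r n M : ℕ} (hr : 0 < r) (ε : ℝ) (c : Equiv.Perm (Fin (2 ^ n)))
    (hM : M ≤ 2 ^ n) :
    recoveryProb r ε c hM = ∑ e : Fin (2 ^ n) → Bool,
      patternProb ε e * (if ∀ i ∈ infoSet c M, erased n e i = false then 1 else 0) := by
  rw [recoveryProb, blockErrorProb_eq hr, sub_eq_iff_eq_add, ← Finset.sum_add_distrib]
  refine (sum_patternProb n ε).symm.trans (Finset.sum_congr rfl fun e _ => ?_)
  split_ifs <;> simp

theorem card_infoSet {n M : ℕ} (c : Equiv.Perm (Fin (2 ^ n))) (hM : M ≤ 2 ^ n) :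
    (infoSet c M).card = M := by
  have : infoSet c M = Finset.univ.image (rowIndex c hM) := by
    ext i; simp [← exists_rowIndex_eq_iff c hM]
  rw [this, Finset.card_image_of_injective _ (rowIndex_injective c hM)]
  simp

theorem recoveryProb_le_one {r n M : ℕ} (hr : 0 < r) {ε : ℝ} (hε : ε ∈ Set.Icc (0 : ℝ) 1)
    (c : Equiv.Perm (Fin (2 ^ n))) (hM : M ≤ 2 ^ n) : recoveryProb r ε c hM ≤ 1 := by
  rw [recoveryProb_eq hr]
  refine (Finset.sum_le_sum fun e _ => ?_).trans_eq (sum_patternProb n ε)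
  refine mul_le_of_le_one_right (patternProb_nonneg hε e) ?_
  split_ifs <;> norm_num

/-- Converse: recovery of `M` packets requires `M` slots without erasure. -/
theorem throughput_le {r n M : ℕ} (hr : 0 < r) {ε : ℝ} (hε : ε ∈ Set.Icc (0 : ℝ) 1)
    (c : Equiv.Perm (Fin (2 ^ n))) (hM : M ≤ 2 ^ n) : throughput r ε c hM ≤ 1 - ε := by
  rw [throughput, recoveryProb_eq hr, div_mul_eq_mul_div, div_le_iff₀ (by positivity)]
  have h1 : ∑ e : Fin (2 ^ n) → Bool, patternProb ε e * ∑ k, (if e k then 0 else 1 : ℝ) =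
      (1 - ε) * 2 ^ n := by
    simp only [Finset.mul_sum]
    rw [Finset.sum_comm]
    simp only [sum_patternProb_slot]
    simp only [Finset.sum_const, Finset.card_univ, Fintype.card_fin, nsmul_eq_mul]
    push_cast
    ring
  rw [← h1, Finset.mul_sum]
  refine Finset.sum_le_sum fun e _ => ?_
  rw [mul_left_comm]
  refine mul_le_mul_of_nonneg_left ?_ (patternProb_nonneg hε e)
  rw [← sum_not_erased]
  split_ifs with h
  · rw [mul_one]
    calc (M : ℝ) = ∑ i ∈ infoSet c M, (if erased n e i then 0 else 1 : ℝ) := by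
          rw [Finset.sum_congr rfl fun i hi => by rw [h i hi]]
          simp [card_infoSet c hM]
      _ ≤ _ := Finset.sum_le_univ_sum_of_nonneg fun i => by split_ifs <;> norm_num
  · rw [mul_zero]
    exact Finset.sum_nonneg fun i _ => by split_ifs <;> norm_num

/-- Union bound over the information packets. -/
theorem one_sub_recoveryProb_le {r n M : ℕ} (hr : 0 < r) {ε : ℝ} (hε : ε ∈ Set.Icc (0 : ℝ) 1)
    (c : Equiv.Perm (Fin (2 ^ n))) (hM : M ≤ 2 ^ n) :
    1 - recoveryProb r ε c hM ≤ ∑ i ∈ infoSet c M, erasureProb r ε n i := by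
  rw [recoveryProb, sub_sub_cancel, blockErrorProb_eq hr]
  simp only [← sum_patternProb_erased hr]
  rw [Finset.sum_comm]
  refine Finset.sum_le_sum fun e _ => ?_
  rw [← Finset.mul_sum]
  refine mul_le_mul_of_nonneg_left ?_ (patternProb_nonneg hε e)
  have h0 : ∀ i ∈ infoSet c M, (0 : ℝ) ≤ if erased n e i then 1 else 0 :=
    fun i _ => by split_ifs <;> norm_num
  split_ifs with h
  · exact Finset.sum_nonneg h0
  · push Not at h
    obtain ⟨i, hi, hei⟩ := h
    refine le_trans ?_ (Finset.single_le_sum h0 hi)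
    rw [if_pos (by simpa using hei)]

/-! ### Limits -/

/-- If sufficiently many synthetic channels have erasure probability at most `t`, then so have all
channels selected by the SPA-v assignment. -/
theorem erasureProb_le_of_mem_infoSet {r n M : ℕ} (hr : 0 < r) {ε t : ℝ}
    {c : Equiv.Perm (Fin (2 ^ n))} (hc : IsCapacityOrder r ε c)
    (hcard : M ≤ (Finset.univ.filter fun i => erasureProb r ε n i ≤ t).card)
    {i : Fin (2 ^ n)} (hi : i ∈ infoSet c M) : erasureProb r ε n i ≤ t := by
  by_contra hlt
  have hr' : (0 : ℝ) < r := by positivity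
  simp only [infoSet, Finset.mem_filter, Finset.mem_univ, true_and] at hi
  -- If the selected channel i were worse than t, every channel meeting t would strictly precede it
  -- in the list, leaving fewer than M of them.
  have hsub : (Finset.univ.filter fun i => erasureProb r ε n i ≤ t) ⊆
      infoSet c (c.symm i : ℕ) := by
    intro j hj
    simp only [infoSet, Finset.mem_filter, Finset.mem_univ, true_and] at hj ⊢
    by_contra hij
    have h := hc (c.symm i) (c.symm j) (not_lt.1 hij)
    simp only [Equiv.apply_symm_apply] at h
    have := div_le_div_of_nonneg_right h hr'.le
    simp only [erasureProb] at hj hlt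
    linarith
  have := Finset.card_le_card hsub
  rw [card_infoSet c (c.symm i).isLt.le] at this
  omega

open Filter Topology

theorem tendsto_recoveryProb {r : ℕ} (hr : 0 < r) {ε : ℝ} (hε : ε ∈ Set.Icc (0 : ℝ) 1)
    {c : (n : ℕ) → Equiv.Perm (Fin (2 ^ n))} (hc : ∀ n, IsCapacityOrder r ε (c n)) {G : ℝ}
    {M : ℕ → ℕ} (hM : ∀ n, M n ≤ 2 ^ n)
    (hG : Tendsto (fun n => (M n : ℝ) / 2 ^ n) atTop (𝓝 G)) (hlt : G < 1 - ε) :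
    Tendsto (fun n => recoveryProb r ε (c n) (hM n)) atTop (𝓝 1) := by
  have hlow : ∀ᶠ n in atTop, 1 - (1 / 2 : ℝ) ^ n ≤ recoveryProb r ε (c n) (hM n) := by
    have hη : 0 < (1 - ε - G) / 2 := by linarith
    filter_upwards [eventually_polarAvg_indicator_le hε hη,
      hG.eventually (gt_mem_nhds (show G < G + (1 - ε - G) / 2 by linarith))] with n h1 h2
    have hp : (0 : ℝ) < 2 ^ n := by positivity
    have hcount := sum_erasureProb hr (fun z => if (4 ^ n : ℝ)⁻¹ < z then 1 else 0) n ε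
    have hcompl : ((Finset.univ.filter fun i => erasureProb r ε n i ≤ (4 ^ n : ℝ)⁻¹).card : ℝ) =
        2 ^ n - ∑ i, (if (4 ^ n : ℝ)⁻¹ < erasureProb r ε n i then 1 else 0 : ℝ) := by
      rw [eq_sub_iff_add_eq, Finset.card_filter]
      push_cast
      rw [← Finset.sum_add_distrib]
      have : ∀ i : Fin (2 ^ n), ((if erasureProb r ε n i ≤ (4 ^ n : ℝ)⁻¹ then 1 else 0 : ℝ) +
          if (4 ^ n : ℝ)⁻¹ < erasureProb r ε n i then 1 else 0) = 1 := fun i => by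
        rcases le_or_gt (erasureProb r ε n i) (4 ^ n : ℝ)⁻¹ with h | h
        · rw [if_pos h, if_neg (not_lt.2 h), add_zero]
        · rw [if_neg (not_le.2 h), if_pos h, zero_add]
      simp [this]
    have hcard : M n ≤ (Finset.univ.filter fun i => erasureProb r ε n i ≤ (4 ^ n : ℝ)⁻¹).card := by
      rw [div_lt_iff₀ hp] at h2
      have h3 := mul_le_mul_of_nonneg_left h1 hp.le
      rw [← @Nat.cast_le ℝ, hcompl, hcount]
      nlinarith
    have hb := one_sub_recoveryProb_le hr hε (c n) (hM n)
    have hs := Finset.sum_le_card_nsmul (infoSet (c n) (M n)) (fun i => erasureProb r ε n i)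
      (4 ^ n : ℝ)⁻¹ fun i hi => erasureProb_le_of_mem_infoSet hr (hc n) hcard hi
    rw [card_infoSet (c n) (hM n), nsmul_eq_mul] at hs
    have hMn : (M n : ℝ) ≤ 2 ^ n := by exact_mod_cast hM n
    have hf : (2 : ℝ) ^ n * (4 ^ n : ℝ)⁻¹ = (1 / 2) ^ n := by
      rw [← inv_pow, ← mul_pow]; norm_num
    have hle := mul_le_mul_of_nonneg_right hMn (show (0 : ℝ) ≤ (4 ^ n : ℝ)⁻¹ by positivity)
    linarith
  have hlim : Tendsto (fun n : ℕ => 1 - (1 / 2 : ℝ) ^ n) atTop (𝓝 1) := by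
    simpa using (tendsto_pow_atTop_nhds_zero_of_lt_one (r := (1 / 2 : ℝ)) (by norm_num)
      (by norm_num)).const_sub 1
  exact tendsto_of_tendsto_of_tendsto_of_le_of_le' hlim tendsto_const_nhds hlow
    (Eventually.of_forall fun n => recoveryProb_le_one hr hε (c n) (hM n))

theorem tendsto_throughput {r : ℕ} (hr : 0 < r) {ε : ℝ} (hε : ε ∈ Set.Icc (0 : ℝ) 1)
    {c : (n : ℕ) → Equiv.Perm (Fin (2 ^ n))} (hc : ∀ n, IsCapacityOrder r ε (c n)) {G : ℝ}
    {M : ℕ → ℕ} (hM : ∀ n, M n ≤ 2 ^ n)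
    (hG : Tendsto (fun n => (M n : ℝ) / 2 ^ n) atTop (𝓝 G)) (hlt : G < 1 - ε) :
    Tendsto (fun n => throughput r ε (c n) (hM n)) atTop (𝓝 G) := by
  simpa [throughput] using hG.mul (tendsto_recoveryProb hr hε hc hM hG hlt)

theorem throughput_le_maxThroughput {r n M : ℕ} (ε : ℝ) (c : Equiv.Perm (Fin (2 ^ n)))
    (hM : M ≤ 2 ^ n) : throughput r ε c hM ≤ maxThroughput r ε c :=
  Finset.le_sup' (fun M : Fin (2 ^ n + 1) => throughput r ε c (Nat.lt_succ_iff.mp M.isLt))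
    (Finset.mem_univ ⟨M, Nat.lt_succ_of_le hM⟩)

theorem maxThroughput_nonneg {r n : ℕ} (ε : ℝ) (c : Equiv.Perm (Fin (2 ^ n))) :
    0 ≤ maxThroughput r ε c := by
  simpa [throughput] using throughput_le_maxThroughput (r := r) ε c (Nat.zero_le _)

theorem tendsto_maxThroughput {r : ℕ} (hr : 0 < r) {ε : ℝ} (hε : ε ∈ Set.Icc (0 : ℝ) 1)
    {c : (n : ℕ) → Equiv.Perm (Fin (2 ^ n))} (hc : ∀ n, IsCapacityOrder r ε (c n)) :
    Tendsto (fun n => maxThroughput r ε (c n)) atTop (𝓝 (1 - ε)) := by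
  refine tendsto_order.2 ⟨fun a ha => ?_, fun a ha => Eventually.of_forall fun n => ?_⟩
  -- Negative a is separated so that G ≥ 0, which the floor as a number of users requires.
  · rcases lt_or_ge a 0 with h0 | h0
    · exact Eventually.of_forall fun n => h0.trans_le (maxThroughput_nonneg ε (c n))
    obtain ⟨G, haG, hG⟩ := exists_between ha
    have hG0 : 0 ≤ G := h0.trans haG.le
    have hM : ∀ n : ℕ, ⌊G * 2 ^ n⌋₊ ≤ 2 ^ n := fun n => by
      have : G * 2 ^ n ≤ ((2 ^ n : ℕ) : ℝ) := by
        push_cast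
        exact mul_le_of_le_one_left (by positivity) (by linarith [hε.1])
      exact Nat.floor_le_of_le this
    have hfl : Tendsto (fun n : ℕ => (⌊G * 2 ^ n⌋₊ : ℝ) / 2 ^ n) atTop (𝓝 G) :=
      (tendsto_nat_floor_mul_div_atTop hG0).comp
        (tendsto_pow_atTop_atTop_of_one_lt (by norm_num : (1 : ℝ) < 2))
    filter_upwards [(tendsto_throughput hr hε hc hM hfl hG).eventually (lt_mem_nhds haG)] with n hn
    exact hn.trans_le (throughput_le_maxThroughput ε (c n) (hM n))
  · refine lt_of_le_of_lt ?_ ha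
    exact Finset.sup'_le _ _ fun M _ => throughput_le hr hε (c n) _

/-! ### Capacity of the slot erasure channel -/

theorem secCapacity_eq (r : ℕ) (ε : ℝ) : secCapacity r ε = r * (1 - ε) := by
  have hcard : ((Fintype.card (Packet r) : ℕ) : ℝ) = 2 ^ r := by simp
  have hp : (2 : ℝ) ^ r ≠ 0 := by positivity
  have hout : ∀ x : Packet r, (∑ x', 1 / (2 : ℝ) ^ r * sec ε (some x) x') =
      1 / 2 ^ r * (1 - ε) := fun x => by simp [sec]
  have hnone : (∑ x' : Packet r, 1 / (2 : ℝ) ^ r * sec ε none x') = ε := by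
    simp only [sec, Finset.sum_const, Finset.card_univ, nsmul_eq_mul, hcard]
    field_simp
  have hlog : (1 - ε) * Real.logb 2 ((1 - ε) / (1 / 2 ^ r * (1 - ε))) = r * (1 - ε) := by
    rcases eq_or_ne (1 - ε) 0 with h | h
    · simp [h]
    · have : (1 - ε) / (1 / 2 ^ r * (1 - ε)) = 2 ^ r := by field_simp
      rw [this, Real.logb_pow, Real.logb_self_eq_one (by norm_num)]
      ring
  have hx : ∀ x : Packet r, (∑ y : Option (Packet r), 1 / (2 : ℝ) ^ r * sec ε y x *
      Real.logb 2 (sec ε y x / ∑ x' : Packet r, 1 / (2 : ℝ) ^ r * sec ε y x')) =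
      1 / 2 ^ r * (r * (1 - ε)) := by
    intro x
    rw [Fintype.sum_option, hnone]
    -- An erasure carries no information: the ratio is 1, or ε = 0 and the prefactor vanishes.
    have h0 : 1 / (2 : ℝ) ^ r * sec ε none x * Real.logb 2 (sec ε none x / ε) = 0 := by
      rcases eq_or_ne ε 0 with h | h
      · simp [sec, h]
      · simp [sec, h]
    rw [h0, zero_add, Finset.sum_eq_single x (fun y _ hy => by simp [sec, hy]) (by simp), hout,
      ← hlog]
    simp only [sec, if_true]
    ring
  simp only [secCapacity, hx, Finset.sum_const, Finset.card_univ, nsmul_eq_mul, hcard]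
  field_simp

end PSA

theorem theorem4 (r : ℕ) (hr : 0 < r) (ε : ℝ) (hε0 : 0 ≤ ε) (hε1 : ε ≤ 1)
    (c : (n : ℕ) → Equiv.Perm (Fin (2 ^ n)))
    (hc : ∀ n, PSA.IsCapacityOrder r ε (c n)) :
    Filter.Tendsto (fun n => PSA.maxThroughput r ε (c n)) Filter.atTop (nhds (1 - ε)) ∧
    (∀ (G : ℝ) (M : ℕ → ℕ) (hM : ∀ n, M n ≤ 2 ^ n),
      Filter.Tendsto (fun n => (M n : ℝ) / 2 ^ n) Filter.atTop (nhds G) → G < 1 - ε →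
      Filter.Tendsto (fun n => PSA.recoveryProb r ε (c n) (hM n)) Filter.atTop (nhds 1) ∧
      Filter.Tendsto (fun n => PSA.throughput r ε (c n) (hM n)) Filter.atTop (nhds G)) ∧
    1 - ε = PSA.secCapacity r ε / r := by
  refine ⟨PSA.tendsto_maxThroughput hr ⟨hε0, hε1⟩ hc, fun G M hM hG hlt =>
    ⟨PSA.tendsto_recoveryProb hr ⟨hε0, hε1⟩ hc hM hG hlt,
      PSA.tendsto_throughput hr ⟨hε0, hε1⟩ hc hM hG hlt⟩, ?_⟩
  rw [PSA.secCapacity_eq, mul_div_cancel_left₀ _ (by positivity)]
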